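/- Throughout, graphs are finite and simple. Let $G$ be a connected graph with vertex set $V$ and distance function $d$; for $x\in V$ and a nonempty $W\subseteq V$ put $d(x,W)=\min\{d(x,w): w\in W\}$. A set $W$ strongly resolves two different vertices $x,y\notin W$ if $d(x,W)=d(x,y)+d(y,W)$ or $d(y,W)=d(y,x)+d(x,W)$. A partition $\Pi$ of $V$ into nonempty sets is a strong resolving partition for $G$ if every two different vertices in the same set of $\Pi$ are strongly resolved by some set of $\Pi$. The strong partition dimension $pd_s(G)$ is the minimum number of sets in a strong resolving partition for $G$. **Theorem.** Let $G$ be a connected graph of order $n$. Then $pd_s(G)=n-1$ if and only if at least one of the following holds: 1. $G$ is isomorphic to the path $P_3$ on three vertices; 2. $G$ is isomorphic to the cycle $C_4$ on four vertices; 3. $G\cong K_n-e$, the graph obtained from the complete graph $K_n$ by deleting one edge; 4. $G\cong K_1+\bigcup_{i=1}^{k}K_{n_i}$ for some integers $k\ge 2$ and $n_1,\dots,n_k\ge 1$ with $\sum_{i=1}^{k}n_i=n-1$, where $\bigcup$ denotes disjoint union and $+$ denotes the join (the disjoint union of the two graphs together with all edges between them). -/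

import Mathlib

namespace StrongPartition

/-- The distance `d_G(x, W) = min {d_G(x, w) : w ∈ W}` from a vertex to a (nonempty) vertex set. -/
noncomputable def distToSet {V : Type*} (G : SimpleGraph V) (x : V) (W : Set V) : ℕ :=
  sInf ((fun w => G.dist x w) '' W)

/-- The vertex set `W` strongly resolves the vertices `x` and `y`, both outside `W`. -/
def StronglyResolves {V : Type*} (G : SimpleGraph V) (W : Set V) (x y : V) : Prop :=
  x ∉ W ∧ y ∉ W ∧
    (distToSet G x W = G.dist x y + distToSet G y W ∨
      distToSet G y W = G.dist y x + distToSet G x W)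

/-- `P` is a partition of the vertex set (into nonempty, pairwise disjoint classes) such that any
two different vertices in the same class are strongly resolved by some class. -/
def IsStrongResolvingPartition {V : Type*} (G : SimpleGraph V) (P : Set (Set V)) : Prop :=
  Setoid.IsPartition P ∧
    ∀ U ∈ P, ∀ x ∈ U, ∀ y ∈ U, x ≠ y → ∃ W ∈ P, StronglyResolves G W x y

/-- The strong partition dimension of a finite graph: the minimum number of classes of a strong
resolving partition. The partition into singletons is one, so the minimum exists. -/
noncomputable def strongPartitionDim {V : Type*} [Fintype V] (G : SimpleGraph V) : ℕ :=
  sInf {k | ∃ P : Set (Set V), IsStrongResolvingPartition G P ∧ P.ncard = k}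

/-- The join `G + H`: the disjoint union of `G` and `H` together with all edges between them. -/
def join {V W : Type*} (G : SimpleGraph V) (H : SimpleGraph W) : SimpleGraph (V ⊕ W) where
  Adj
    | Sum.inl u, Sum.inl v => G.Adj u v
    | Sum.inr u, Sum.inr v => H.Adj u v
    | Sum.inl _, Sum.inr _ => True
    | Sum.inr _, Sum.inl _ => True
  symm := ⟨by
    rintro (u | u) (v | v) h
    · exact G.symm.symm _ _ h
    · trivial
    · trivial
    · exact H.symm.symm _ _ h⟩
  loopless := ⟨by
    rintro (u | u) h
    · exact G.loopless.irrefl _ h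
    · exact H.loopless.irrefl _ h⟩

/-- The disjoint union of a family of graphs. -/
def disjointUnion {ι : Type*} {V : ι → Type*} (H : ∀ i, SimpleGraph (V i)) :
    SimpleGraph (Σ i, V i) where
  Adj x y := ∃ (i : ι) (a b : V i), (H i).Adj a b ∧ x = ⟨i, a⟩ ∧ y = ⟨i, b⟩
  symm := ⟨by
    rintro x y ⟨i, a, b, h, hx, hy⟩
    exact ⟨i, b, a, h.symm, hy, hx⟩⟩
  loopless := ⟨by
    rintro x ⟨i, a, b, h, rfl, hy⟩
    obtain rfl : a = b := by simpa using hy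
    exact (H i).loopless.irrefl _ h⟩

end StrongPartition

/-! A singleton class `{w}` strongly resolves adjacent `x`, `y` as soon as `w` is adjacent to
exactly one of them. Merging the first two vertices of an induced path on three vertices therefore
gives dimension at most `n - 1`, and merging three vertices, or two disjoint pairs, gives at most `n
- 2` when outside singletons resolve the merged pairs.

So dimension at least `n - 1` forces diameter at most two (`dist_le_two_of_card_le`) and forbids a
triangle each of whose edges is separated by some vertex (`triangle_of_card_le`) and two disjoint
edges separated by the same vertex (`pairs_of_card_le`). For a noncomplete graph the number of
universal vertices then decides: none gives `C_4`, exactly one a join of `K_1` with cliques, at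
least two `K_n - e`. A complete graph has dimension `n`, and `P_3` is `K_3 - e`.

Conversely, in diameter two a class resolves only adjacent pairs of which one vertex has a neighbour
in the class and the other has none (`StronglyResolves.exists_adj`). In each shape this puts all
vertices but a suitable one into different classes. -/

namespace StrongPartition

/-! ### Partitions given by maps, and counting classes -/

variable {V : Type*} {G : SimpleGraph V}

/-- The vertex `w`, taken as a one-element set, strongly resolves `x` and `y`. -/
def VertexResolves (G : SimpleGraph V) (w x y : V) : Prop :=
  G.dist x w = G.dist x y + G.dist y w ∨ G.dist y w = G.dist y x + G.dist x w

theorem VertexResolves.symm {w x y : V} (h : VertexResolves G w x y) :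
    VertexResolves G w y x := Or.symm h

theorem distToSet_singleton (x w : V) : distToSet G x {w} = G.dist x w := by
  simp [distToSet]

/-- The classes are the fibres of `f`. The condition on `w` makes its fibre a singleton, so that
`{w}` is the resolving class. -/
theorem strongPartitionDim_le_ncard_range [Fintype V] (f : V → V)
    (h : ∀ x y, x ≠ y → f x = f y → ∃ w, (∀ v, f v = f w → v = w) ∧ VertexResolves G w x y) :
    strongPartitionDim G ≤ (Set.range f).ncard := by
  have hcard : (Setoid.ker f).classes.ncard ≤ (Set.range f).ncard := by
    have : (Setoid.ker f).classes = (fun a => f ⁻¹' {a}) '' Set.range f := by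
      ext s
      simp only [Setoid.classes, Set.mem_ofPred_eq, Set.mem_image, Set.mem_range,
        exists_exists_eq_and]
      exact exists_congr fun a => eq_comm
    rw [this]
    exact Set.ncard_image_le (Set.toFinite _)
  refine le_trans (Nat.sInf_le ⟨_, ⟨Setoid.isPartition_classes _, ?_⟩, rfl⟩) hcard
  rintro U ⟨c, rfl⟩ x hx y hy hxy
  have hxy' : f x = f y := Eq.trans hx (Eq.symm hy)
  obtain ⟨w, hw, hr⟩ := h x y hxy hxy'
  have hW : {v | Setoid.ker f v w} = {w} := by
    ext v
    exact ⟨hw v, fun e => congrArg f e⟩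
  refine ⟨_, ⟨w, rfl⟩, ?_⟩
  rw [hW]
  refine ⟨fun e => hxy ?_, fun e => hxy ?_, ?_⟩
  · obtain rfl : x = w := e
    exact (hw y hxy'.symm).symm
  · obtain rfl : y = w := e
    exact hw x hxy'
  · simpa [distToSet_singleton, VertexResolves] using hr

theorem exists_isStrongResolvingPartition_ncard_eq [Fintype V] (G : SimpleGraph V) :
    ∃ P : Set (Set V), IsStrongResolvingPartition G P ∧ P.ncard = strongPartitionDim G := by
  refine Nat.sInf_mem (s := {k | ∃ P : Set (Set V), IsStrongResolvingPartition G P ∧ P.ncard = k})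
    ⟨_, (Setoid.ker (id : V → V)).classes, ⟨Setoid.isPartition_classes _, ?_⟩, rfl⟩
  rintro U ⟨c, rfl⟩ x hx y hy hxy
  exact absurd (Eq.trans hx (Eq.symm hy)) hxy

theorem ncard_le_ncard_partition [Fintype V] {P : Set (Set V)} (hP : Setoid.IsPartition P)
    (S : Set V) (hS : ∀ U ∈ P, ∀ x ∈ U, ∀ y ∈ U, x ∈ S → y ∈ S → x = y) :
    S.ncard ≤ P.ncard := by
  choose g hg _ using fun x => hP.2 x
  refine Set.ncard_le_ncard_of_injOn g (fun x _ => (hg x).1) ?_ (Set.toFinite _)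
  intro x hx y hy hxy
  exact hS _ (hg x).1 x (hg x).2 y (by rw [hxy]; exact (hg y).2) hx hy

/-- The vertices other than `v` inject into the classes; `v` may depend on the partition. -/
theorem card_sub_one_le_strongPartitionDim [Fintype V]
    (h : ∀ P, IsStrongResolvingPartition G P →
      ∃ v, ∀ U ∈ P, ∀ x ∈ U, ∀ y ∈ U, x ≠ v → y ≠ v → x = y) :
    Fintype.card V - 1 ≤ strongPartitionDim G := by
  classical
  obtain ⟨P, hP, hk⟩ := exists_isStrongResolvingPartition_ncard_eq G
  obtain ⟨v, hv⟩ := h P hP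
  have := ncard_le_ncard_partition hP.1 {v}ᶜ hv
  rw [Set.ncard_compl, Set.ncard_singleton, Nat.card_eq_fintype_card] at this
  omega

/-! ### Strong resolution in terms of adjacency -/

theorem distToSet_le {x w : V} {W : Set V} (hw : w ∈ W) : distToSet G x W ≤ G.dist x w :=
  Nat.sInf_le ⟨w, hw, rfl⟩

theorem exists_dist_eq_distToSet (x : V) {W : Set V} (hW : W.Nonempty) :
    ∃ w ∈ W, distToSet G x W = G.dist x w := by
  obtain ⟨w, hw, he⟩ := Nat.sInf_mem (hW.image fun w => G.dist x w)
  exact ⟨w, hw, he.symm⟩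

/-- In a graph of diameter at most two, strong resolution is one-sided adjacency. -/
theorem StronglyResolves.exists_adj (hG : G.Connected) (hd : ∀ x y, G.dist x y ≤ 2)
    {W : Set V} (hW : W.Nonempty) {x y : V} (hxy : x ≠ y) (h : StronglyResolves G W x y) :
    G.Adj x y ∧ (((∃ w ∈ W, G.Adj y w) ∧ ∀ w ∈ W, ¬ G.Adj x w) ∨
      ((∃ w ∈ W, G.Adj x w) ∧ ∀ w ∈ W, ¬ G.Adj y w)) := by
  have key : ∀ {x y : V}, x ≠ y → y ∉ W →
      distToSet G x W = G.dist x y + distToSet G y W →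
      G.Adj x y ∧ (∃ w ∈ W, G.Adj y w) ∧ ∀ w ∈ W, ¬ G.Adj x w := by
    intro x y hxy hy he
    -- Both summands are positive and the left side is at most 2, so both summands are 1.
    have h1 := hG.pos_dist_of_ne hxy
    obtain ⟨w, hw, hyw⟩ := exists_dist_eq_distToSet (G := G) y hW
    have h2 := hG.pos_dist_of_ne (show y ≠ w by rintro rfl; exact hy hw)
    have h3 := (distToSet_le (G := G) (x := x) hw).trans (hd x w)
    refine ⟨SimpleGraph.dist_eq_one_iff_adj.1 (by omega), ⟨w, hw,
      SimpleGraph.dist_eq_one_iff_adj.1 (by omega)⟩, fun u hu hxu => ?_⟩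
    have := SimpleGraph.dist_eq_one_iff_adj.2 hxu
    have := distToSet_le (G := G) (x := x) hu
    omega
  obtain ⟨hx, hy, h | h⟩ := h
  · exact ⟨(key hxy hy h).1, Or.inl (key hxy hy h).2⟩
  · exact ⟨(key hxy.symm hx h).1.symm, Or.inr (key hxy.symm hx h).2⟩

theorem vertexResolves_of_adj {w x y : V} (hxy : G.Adj x y) (hyw : G.Adj y w)
    (hne : x ≠ w) (hxw : ¬ G.Adj x w) : VertexResolves G w x y := by
  left
  have h1 := SimpleGraph.dist_eq_one_iff_adj.2 hxy
  have h2 := SimpleGraph.dist_eq_one_iff_adj.2 hyw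
  have h3 : G.dist x w ≤ 2 := SimpleGraph.dist_le (.cons hxy (.cons hyw .nil))
  have h4 : G.dist x w ≠ 1 := fun h => hxw (SimpleGraph.dist_eq_one_iff_adj.1 h)
  have h5 : 0 < G.dist x w :=
    SimpleGraph.Reachable.pos_dist_of_ne ⟨.cons hxy (.cons hyw .nil)⟩ hne
  omega

/-- `w` is a further vertex, adjacent to exactly one of `x` and `y`. -/
def Separates (G : SimpleGraph V) (w x y : V) : Prop :=
  w ≠ x ∧ w ≠ y ∧ ¬ (G.Adj w x ↔ G.Adj w y)

theorem Separates.vertexResolves {w x y : V} (h : Separates G w x y) (hxy : G.Adj x y) :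
    VertexResolves G w x y := by
  obtain ⟨hx, hy, h⟩ := h
  by_cases hwx : G.Adj w x
  · have hwy : ¬ G.Adj w y := fun h' => h ⟨fun _ => h', fun _ => hwx⟩
    exact (vertexResolves_of_adj hxy.symm hwx.symm hy.symm fun e => hwy e.symm).symm
  · have hwy : G.Adj w y := by
      by_contra h'
      exact h ⟨fun e => absurd e hwx, fun e => absurd e h'⟩
    exact vertexResolves_of_adj hxy hwy.symm hx.symm fun e => hwx e.symm

/-! ### Upper bounds by merging vertices -/

theorem strongPartitionDim_add_one_le [Fintype V] {a b w : V} (hab : G.Adj a b)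
    (h : Separates G w a b) : strongPartitionDim G + 1 ≤ Fintype.card V := by
  classical
  have hne := hab.ne
  have hr := h.vertexResolves hab
  have := strongPartitionDim_le_ncard_range (G := G) (fun v => if v = b then a else v) (by
    intro x y hxy hf
    refine ⟨w, ?_, ?_⟩
    · have := h.1; have := h.2.1
      grind
    · have : (x = a ∧ y = b) ∨ (x = b ∧ y = a) := by grind
      rcases this with ⟨rfl, rfl⟩ | ⟨rfl, rfl⟩
      exacts [hr, hr.symm])
  have h2 : (Set.range fun v => if v = b then a else v).ncard ≤ ({b}ᶜ : Set V).ncard :=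
    Set.ncard_le_ncard (by
      rintro _ ⟨v, rfl⟩
      simp only [Set.mem_compl_iff, Set.mem_singleton_iff]
      grind) (Set.toFinite _)
  rw [Set.ncard_compl, Set.ncard_singleton, Nat.card_eq_fintype_card] at h2
  have := Fintype.card_pos_iff.2 ⟨a⟩
  omega

/-- Merging `b` into `p` and `c` into `q`. -/
theorem strongPartitionDim_add_two_le [Fintype V] [DecidableEq V] {b c p q : V} (hbc : b ≠ c)
    (hpb : p ≠ b) (hpc : p ≠ c) (hqb : q ≠ b) (hqc : q ≠ c)
    (h : ∀ x y, x ≠ y →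
      (if x = b then p else if x = c then q else x) =
        (if y = b then p else if y = c then q else y) →
      ∃ w, w ≠ b ∧ w ≠ c ∧ w ≠ p ∧ w ≠ q ∧ VertexResolves G w x y) :
    strongPartitionDim G + 2 ≤ Fintype.card V := by
  have := strongPartitionDim_le_ncard_range (G := G)
    (fun v => if v = b then p else if v = c then q else v) (by
    intro x y hxy hf
    obtain ⟨w, h1, h2, h3, h4, hr⟩ := h x y hxy hf
    exact ⟨w, by grind, hr⟩)
  have h2 : (Set.range fun v => if v = b then p else if v = c then q else v).ncard ≤
      ({b, c}ᶜ : Set V).ncard :=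
    Set.ncard_le_ncard (by
      rintro _ ⟨v, rfl⟩
      simp only [Set.mem_compl_iff, Set.mem_insert_iff, Set.mem_singleton_iff]
      grind) (Set.toFinite _)
  rw [Set.ncard_compl, Set.ncard_pair hbc, Nat.card_eq_fintype_card] at h2
  have : ({b, c} : Finset V).card ≤ Fintype.card V := Finset.card_le_univ _
  rw [Finset.card_pair hbc] at this
  omega

theorem strongPartitionDim_add_two_le_of_triple [Fintype V] {a b c u v w : V}
    (hab : a ≠ b) (hac : a ≠ c) (hbc : b ≠ c)
    (hu : u ≠ a ∧ u ≠ b ∧ u ≠ c) (hv : v ≠ a ∧ v ≠ b ∧ v ≠ c) (hw : w ≠ a ∧ w ≠ b ∧ w ≠ c)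
    (h1 : VertexResolves G u a b) (h2 : VertexResolves G v a c) (h3 : VertexResolves G w b c) :
    strongPartitionDim G + 2 ≤ Fintype.card V := by
  classical
  refine strongPartitionDim_add_two_le hbc hab hac hab hac fun x y hxy hf => ?_
  have : (x = a ∧ y = b) ∨ (x = b ∧ y = a) ∨ (x = a ∧ y = c) ∨ (x = c ∧ y = a) ∨
    (x = b ∧ y = c) ∨ (x = c ∧ y = b) := by grind
  have := h1.symm; have := h2.symm; have := h3.symm
  grind

theorem strongPartitionDim_add_two_le_of_pairs [Fintype V] {a b c d w : V}
    (hab : G.Adj a b) (hcd : G.Adj c d)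
    (hac : a ≠ c) (had : a ≠ d) (hbc : b ≠ c) (hbd : b ≠ d)
    (h1 : Separates G w a b) (h2 : Separates G w c d) :
    strongPartitionDim G + 2 ≤ Fintype.card V := by
  classical
  have h1' := h1.vertexResolves hab
  have h2' := h2.vertexResolves hcd
  have := hab.ne
  have := hcd.ne
  refine strongPartitionDim_add_two_le (b := b) (c := d) (p := a) (q := c) hbd hab.ne had
    hbc.symm hcd.ne fun x y hxy hf => ?_
  have : (x = a ∧ y = b) ∨ (x = b ∧ y = a) ∨ (x = c ∧ y = d) ∨ (x = d ∧ y = c) := by grind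
  have := h1'.symm; have := h2'.symm
  exact ⟨w, h1.2.1, h2.2.1, h1.1, h2.1, by grind⟩

/-- The vertex separating an edge is never the third corner, since that corner is adjacent to both
ends. It thus stays outside the merged triple. -/
theorem strongPartitionDim_add_two_le_of_triangle [Fintype V] {a b c u v w : V}
    (hab : G.Adj a b) (hac : G.Adj a c) (hbc : G.Adj b c)
    (hu : Separates G u a b) (hv : Separates G v a c) (hw : Separates G w b c) :
    strongPartitionDim G + 2 ≤ Fintype.card V := by
  have h1 := hu.vertexResolves hab
  have h2 := hv.vertexResolves hac
  have h3 := hw.vertexResolves hbc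
  have := hab.symm; have := hac.symm; have := hbc.symm
  refine strongPartitionDim_add_two_le_of_triple hab.ne hac.ne hbc.ne ⟨hu.1, hu.2.1, ?_⟩
    ⟨hv.1, ?_, hv.2.1⟩ ⟨?_, hw.1, hw.2.1⟩ h1 h2 h3
  · rintro rfl; exact hu.2.2 (by tauto)
  · rintro rfl; exact hv.2.2 (by tauto)
  · rintro rfl; exact hw.2.2 (by tauto)

/-! ### Diameter at most two -/

theorem exists_adj_dist_eq (hG : G.Connected) {a y : V} {m : ℕ} (h : G.dist a y = m + 1) :
    ∃ b, G.Adj a b ∧ G.dist b y = m := by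
  obtain ⟨p, hp⟩ := hG.exists_walk_length_eq_dist a y
  cases p with
  | nil => simp at h
  | @cons _ b _ hab q =>
    refine ⟨b, hab, ?_⟩
    have h1 := SimpleGraph.dist_le q
    have h2 := hG.dist_triangle (u := a) (v := b) (w := y)
    have h3 := SimpleGraph.dist_eq_one_iff_adj.2 hab
    simp only [SimpleGraph.Walk.length_cons] at hp
    omega

theorem dist_le_two_of_card_le [Fintype V] (hG : G.Connected)
    (hlow : Fintype.card V ≤ strongPartitionDim G + 1) (x y : V) : G.dist x y ≤ 2 := by
  by_contra! h
  -- Along a geodesic from `x` the far end `y` resolves every pair. The first three vertices `x`,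
  -- `b`, `c` can be merged, as `c` is still at distance `k + 1 > 0` from `y`.
  obtain ⟨k, hk⟩ : ∃ k, G.dist x y = k + 2 + 1 := ⟨G.dist x y - 3, by omega⟩
  obtain ⟨b, hb, hby⟩ := exists_adj_dist_eq hG hk
  obtain ⟨c, hc, hcy⟩ := exists_adj_dist_eq hG hby
  have h1 := SimpleGraph.dist_eq_one_iff_adj.2 hb
  have h2 := SimpleGraph.dist_eq_one_iff_adj.2 hc
  have h3 := hG.dist_triangle (u := x) (v := b) (w := c)
  have h4 := hG.dist_triangle (u := x) (v := c) (w := y)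
  have h0 : G.dist y y = 0 := SimpleGraph.dist_self
  have hy : y ≠ x ∧ y ≠ b ∧ y ≠ c :=
    ⟨by rintro rfl; omega, by rintro rfl; omega, by rintro rfl; omega⟩
  have := strongPartitionDim_add_two_le_of_triple (G := G) hb.ne (b := b) (c := c)
    (by rintro rfl; omega) hc.ne hy hy hy (Or.inl (by omega)) (Or.inl (by omega))
    (Or.inl (by omega))
  omega

theorem exists_common_neighbor [Fintype V] (hG : G.Connected)
    (hlow : Fintype.card V ≤ strongPartitionDim G + 1) {x y : V} (hxy : x ≠ y)
    (hn : ¬ G.Adj x y) : ∃ b, G.Adj x b ∧ G.Adj b y := by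
  have h1 := dist_le_two_of_card_le hG hlow x y
  have h2 := hG.pos_dist_of_ne hxy
  have h3 : G.dist x y ≠ 1 := fun h => hn (SimpleGraph.dist_eq_one_iff_adj.1 h)
  obtain ⟨b, hb, h⟩ := exists_adj_dist_eq hG (show G.dist x y = 1 + 1 by omega)
  exact ⟨b, hb, SimpleGraph.dist_eq_one_iff_adj.1 h⟩

theorem dist_le_two_of_common_neighbor
    (h : ∀ x y, x ≠ y → ¬ G.Adj x y → ∃ b, G.Adj x b ∧ G.Adj b y) (x y : V) :
    G.dist x y ≤ 2 := by
  by_cases hxy : x = y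
  · subst hxy; simp
  by_cases hn : G.Adj x y
  · rw [SimpleGraph.dist_eq_one_iff_adj.2 hn]; omega
  obtain ⟨b, h1, h2⟩ := h x y hxy hn
  exact SimpleGraph.dist_le (.cons h1 (.cons h2 .nil))

theorem strongPartitionDim_add_one_le_of_path [Fintype V] {x y z : V} (hxy : G.Adj x y)
    (hyz : G.Adj y z) (hne : x ≠ z) (hn : ¬ G.Adj x z) :
    strongPartitionDim G + 1 ≤ Fintype.card V :=
  strongPartitionDim_add_one_le hxy (w := z)
    ⟨hne.symm, hyz.ne.symm, fun h => hn (h.2 hyz.symm).symm⟩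

theorem exists_nonadj_of_strongPartitionDim_eq [Fintype V] (hG : G.Connected)
    (h : strongPartitionDim G = Fintype.card V - 1) : ∃ x y, x ≠ y ∧ ¬ G.Adj x y := by
  by_contra! hc
  obtain ⟨P, hP, hk⟩ := exists_isStrongResolvingPartition_ncard_eq G
  have hd : ∀ x y, G.dist x y ≤ 2 :=
    dist_le_two_of_common_neighbor fun x y hxy hn => absurd (hc x y hxy) hn
  have := ncard_le_ncard_partition hP.1 Set.univ (by
    intro U hU x hx y hy _ _
    by_contra hxy
    obtain ⟨W, hW, hr⟩ := hP.2 U hU x hx y hy hxy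
    have hne := Setoid.nonempty_of_mem_partition hP.1 hW
    obtain ⟨w, hw⟩ := hne
    rcases (hr.exists_adj hG hd ⟨w, hw⟩ hxy).2 with ⟨_, h⟩ | ⟨_, h⟩
    · exact h w hw (hc _ _ (by rintro rfl; exact hr.1 hw))
    · exact h w hw (hc _ _ (by rintro rfl; exact hr.2.1 hw)))
  rw [Set.ncard_univ, Nat.card_eq_fintype_card, hk] at this
  -- Without a vertex, the truncated `n - 1` would equal `n`.
  have := Fintype.card_pos_iff.2 hG.nonempty
  omega

/-! ### The three shapes and their dimension -/

/-- `v` is adjacent to all other vertices, and `G - v` is a disjoint union of at least two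
complete graphs. -/
def IsCliqueStar (G : SimpleGraph V) (v : V) : Prop :=
  (∀ x, x ≠ v → G.Adj v x) ∧
    (∀ x y z, x ≠ v → y ≠ v → z ≠ v → x ≠ z → G.Adj x y → G.Adj y z → G.Adj x z) ∧
      ∃ x y, x ≠ y ∧ ¬ G.Adj x y

/-- `u` and `v` are the only two nonadjacent vertices. -/
def IsCompleteMinus (G : SimpleGraph V) (u v : V) : Prop :=
  u ≠ v ∧ ∀ x y, G.Adj x y ↔ x ≠ y ∧ ¬ (x = u ∧ y = v) ∧ ¬ (x = v ∧ y = u)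

/-- `a`, `b`, `c`, `d` are all vertices, and form an induced cycle in this order. -/
def IsFourCycle (G : SimpleGraph V) (a b c d : V) : Prop :=
  (∀ x, x = a ∨ x = b ∨ x = c ∨ x = d) ∧ a ≠ c ∧ b ≠ d ∧
    G.Adj a b ∧ G.Adj b c ∧ G.Adj c d ∧ G.Adj d a ∧ ¬ G.Adj a c ∧ ¬ G.Adj b d

theorem IsCliqueStar.strongPartitionDim_eq [Fintype V] (hG : G.Connected) {v : V}
    (h : IsCliqueStar G v) : strongPartitionDim G = Fintype.card V - 1 := by
  obtain ⟨hv, ht, x, y, hxy, hn⟩ := h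
  have hd : ∀ x y, G.dist x y ≤ 2 := dist_le_two_of_common_neighbor fun x y hxy hn =>
    ⟨v, (hv x fun e => hn (e ▸ hv y fun e' => hxy (e.trans e'.symm))).symm,
      hv y fun e => hn (e ▸ (hv x fun e' => hxy (e'.trans e.symm)).symm)⟩
  have hxv : x ≠ v := by rintro rfl; exact hn (hv y hxy.symm)
  have hyv : y ≠ v := by rintro rfl; exact hn (hv x hxy).symm
  have h1 := strongPartitionDim_add_one_le_of_path (hv x hxv).symm (hv y hyv) hxy hn
  have h2 := card_sub_one_le_strongPartitionDim (G := G) fun P hP => ⟨v, by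
    intro U hU x hx y hy hxv hyv
    by_contra hxy
    obtain ⟨W, hW, hr⟩ := hP.2 U hU x hx y hy hxy
    have hne := Setoid.nonempty_of_mem_partition hP.1 hW
    obtain ⟨ha, h⟩ := hr.exists_adj hG hd hne hxy
    rcases h with ⟨⟨w, hw, hyw⟩, h⟩ | ⟨⟨w, hw, hyw⟩, h⟩
    -- Since `x` has no neighbour in `W`, the centre is not in `W`; transitivity along `x`, `y`, `w`
    -- then makes `x` adjacent to `w`.
    · have hwv : w ≠ v := by rintro rfl; exact h _ hw (hv x hxv).symm
      exact h w hw (ht x y w hxv hyv hwv (by rintro rfl; exact hr.1 hw) ha hyw)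
    · have hwv : w ≠ v := by rintro rfl; exact h _ hw (hv y hyv).symm
      exact h w hw (ht y x w hyv hxv hwv (by rintro rfl; exact hr.2.1 hw) ha.symm hyw)⟩
  omega

/-- If each vertex has at most one non-neighbour, then two vertices in a class of a strong
resolving partition have the non-neighbour of one of them as a singleton class. -/
theorem IsStrongResolvingPartition.exists_singleton_mem {P : Set (Set V)}
    (hP : IsStrongResolvingPartition G P) (hG : G.Connected) (hd : ∀ x y, G.dist x y ≤ 2)
    (hu : ∀ x y z, x ≠ y → x ≠ z → ¬ G.Adj x y → ¬ G.Adj x z → y = z)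
    {U : Set V} (hU : U ∈ P) {x y : V} (hx : x ∈ U) (hy : y ∈ U) (hxy : x ≠ y) :
    G.Adj x y ∧ ∃ w, {w} ∈ P ∧ ((w ≠ x ∧ ¬ G.Adj x w) ∨ (w ≠ y ∧ ¬ G.Adj y w)) := by
  obtain ⟨W, hW, hr⟩ := hP.2 U hU x hx y hy hxy
  have hne := Setoid.nonempty_of_mem_partition hP.1 hW
  obtain ⟨ha, h⟩ := hr.exists_adj hG hd hne hxy
  refine ⟨ha, ?_⟩
  rcases h with ⟨⟨w, hw, _⟩, h⟩ | ⟨⟨w, hw, _⟩, h⟩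
  · have hxn : ∀ v ∈ W, x ≠ v := by rintro v hv rfl; exact hr.1 hv
    obtain rfl : W = {w} := Set.eq_singleton_iff_unique_mem.2
      ⟨hw, fun v hv => hu x v w (hxn v hv) (hxn w hw) (h v hv) (h w hw)⟩
    exact ⟨w, hW, Or.inl ⟨(hxn w hw).symm, h w hw⟩⟩
  · have hxn : ∀ v ∈ W, y ≠ v := by rintro v hv rfl; exact hr.2.1 hv
    obtain rfl : W = {w} := Set.eq_singleton_iff_unique_mem.2
      ⟨hw, fun v hv => hu y v w (hxn v hv) (hxn w hw) (h v hv) (h w hw)⟩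
    exact ⟨w, hW, Or.inr ⟨(hxn w hw).symm, h w hw⟩⟩

theorem eq_of_mem_of_singleton_mem {P : Set (Set V)} (hP : Setoid.IsPartition P) {w x y : V}
    (hw : {w} ∈ P) {U : Set V} (hU : U ∈ P) (hx : x ∈ U) (hy : y ∈ U) (h : w = x ∨ w = y) :
    x = y := by
  have key : w ∈ U → x = y := fun hwU => by
    have := (hP.2 w).unique ⟨hw, rfl⟩ ⟨hU, hwU⟩
    subst this
    exact Eq.trans hx (Eq.symm hy)
  rcases h with rfl | rfl
  exacts [key hx, key hy]

theorem IsCompleteMinus.strongPartitionDim_eq [Fintype V] (hG : G.Connected) {u v : V}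
    (h : IsCompleteMinus G u v) : strongPartitionDim G = Fintype.card V - 1 := by
  obtain ⟨huv, ha⟩ := h
  have : Nontrivial V := ⟨u, v, huv⟩
  obtain ⟨b, hb⟩ := hG.preconnected.exists_adj_of_nontrivial u
  have hd : ∀ x y, G.dist x y ≤ 2 := dist_le_two_of_common_neighbor fun x y hxy hn =>
    ⟨b, by simp only [ha] at *; grind⟩
  have h1 := strongPartitionDim_add_one_le_of_path (G := G) (x := u) (y := b) (z := v) hb
    (by simp only [ha] at *; grind) huv (by simp only [ha] at *; grind)
  have hu : ∀ x y z, x ≠ y → x ≠ z → ¬ G.Adj x y → ¬ G.Adj x z → y = z := by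
    simp only [ha] at *; grind
  have h2 := card_sub_one_le_strongPartitionDim (G := G) fun P hP => by
    have key : ∀ U ∈ P, ∀ x ∈ U, ∀ y ∈ U, x ≠ y →
        ({u} ∈ P ∧ (x = v ∨ y = v)) ∨ ({v} ∈ P ∧ (x = u ∨ y = u)) := by
      intro U hU x hx y hy hxy
      obtain ⟨_, w, hw, h⟩ := hP.exists_singleton_mem hG hd hu hU hx hy hxy
      simp only [ha] at h
      grind
    -- If `{u}` is a class, no merged pair contains `u`, so each contains `v`; otherwise each
    -- contains `u`.
    by_cases hs : {u} ∈ P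
    · refine ⟨v, fun U hU x hx y hy hxv hyv => ?_⟩
      by_contra hxy
      rcases key U hU x hx y hy hxy with h | h
      · exact h.2.elim hxv hyv
      · exact hxy (eq_of_mem_of_singleton_mem hP.1 hs hU hx hy (h.2.imp Eq.symm Eq.symm))
    · refine ⟨u, fun U hU x hx y hy hxv hyv => ?_⟩
      by_contra hxy
      rcases key U hU x hx y hy hxy with h | h
      · exact hs h.1
      · exact h.2.elim hxv hyv
  omega

theorem IsFourCycle.strongPartitionDim_eq [Fintype V] (hG : G.Connected) {a b c d : V}
    (h : IsFourCycle G a b c d) : strongPartitionDim G = Fintype.card V - 1 := by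
  obtain ⟨hall, hac, hbd, hab, hbc, hcd, hda, nac, nbd⟩ := h
  have h1 := strongPartitionDim_add_one_le_of_path hab hbc hac nac
  have sy := fun x y => G.adj_comm x y
  have ir := fun x => G.irrefl (v := x)
  have hd : ∀ x y, G.dist x y ≤ 2 := dist_le_two_of_common_neighbor fun x y hxy hn => by
    have := hall x; have := hall y
    grind
  have hu : ∀ x y z, x ≠ y → x ≠ z → ¬ G.Adj x y → ¬ G.Adj x z → y = z := by
    intro x y z
    have := hall x; have := hall y; have := hall z
    grind
  have h2 := card_sub_one_le_strongPartitionDim (G := G) fun P hP => by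
    by_cases hs : ∀ U ∈ P, ∀ x ∈ U, ∀ y ∈ U, x = y
    · exact ⟨a, fun U hU x hx y hy _ _ => hs U hU x hx y hy⟩
    push Not at hs
    obtain ⟨U, hU, x, hx, y, hy, hxy⟩ := hs
    have key : ∀ x y w, x ∈ U → y ∈ U → G.Adj x y → {w} ∈ P → w ≠ x → ¬ G.Adj x w →
        ∀ U' ∈ P, ∀ x' ∈ U', ∀ y' ∈ U', x' ≠ x → y' ≠ x → x' = y' := by
      intro x y w hx hy hxy hw hwx hxw U' hU' x' hx' y' hy' hxx hyx
      by_contra hne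
      have e1 : w ≠ x' ∧ w ≠ y' := not_or.1 fun h =>
        hne (eq_of_mem_of_singleton_mem hP.1 hw hU' hx' hy' h)
      have hyw : y ≠ w := by
        rintro rfl; exact hxw hxy
      -- Only two vertices differ from both `x` and `w`, and `y` is one of them. Hence `x'`, `y'`
      -- lie in the class of `x`, whose members are pairwise adjacent, but a four-cycle has no
      -- triangle.
      have e2 : y = x' ∨ y = y' := by
        have := hall x; have := hall y; have := hall x'; have := hall y'; have := hall w
        grind
      have e3 : U = U' := by
        refine (hP.1.2 y).unique ⟨hU, hy⟩ ⟨hU', ?_⟩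
        rcases e2 with rfl | rfl <;> assumption
      subst e3
      have f1 := (hP.exists_singleton_mem hG hd hu hU hx hx' hxx.symm).1
      have f2 := (hP.exists_singleton_mem hG hd hu hU hx hy' hyx.symm).1
      have f3 := (hP.exists_singleton_mem hG hd hu hU hx' hy' hne).1
      have := hall x; have := hall x'; have := hall y'
      grind
    obtain ⟨hA, w, hw, h | h⟩ := hP.exists_singleton_mem hG hd hu hU hx hy hxy
    · exact ⟨x, key x y w hx hy hA hw h.1 h.2⟩
    · exact ⟨y, key y x w hy hx hA.symm hw h.1 h.2⟩
  omega

/-! ### From the bound to the shapes -/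

theorem triangle_of_card_le [Fintype V] (hlow : Fintype.card V ≤ strongPartitionDim G + 1)
    {a b c u v w : V} (hab : G.Adj a b) (hac : G.Adj a c) (hbc : G.Adj b c)
    (hu : Separates G u a b) (hv : Separates G v a c) (hw : Separates G w b c) : False := by
  have := strongPartitionDim_add_two_le_of_triangle hab hac hbc hu hv hw
  omega

theorem pairs_of_card_le [Fintype V] (hlow : Fintype.card V ≤ strongPartitionDim G + 1)
    {a b c d w : V} (hab : G.Adj a b) (hcd : G.Adj c d)
    (hac : a ≠ c) (had : a ≠ d) (hbc : b ≠ c) (hbd : b ≠ d)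
    (h1 : Separates G w a b) (h2 : Separates G w c d) : False := by
  have := strongPartitionDim_add_two_le_of_pairs hab hcd hac had hbc hbd h1 h2
  omega

theorem isCliqueStar_of_unique_universal [Fintype V]
    (hlow : Fintype.card V ≤ strongPartitionDim G + 1) {v : V}
    (hv : ∀ x, x ≠ v → G.Adj v x) (huniq : ∀ y, y ≠ v → ∃ z, z ≠ y ∧ ¬ G.Adj y z)
    (hn : ∃ x y, x ≠ y ∧ ¬ G.Adj x y) : IsCliqueStar G v := by
  refine ⟨hv, fun x y z hx hy hz hxz hxy hyz => ?_, hn⟩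
  by_contra hnxz
  obtain ⟨t, hty, hnt⟩ := huniq y hy
  have htv : t ≠ v := by rintro rfl; exact hnt (hv y hy).symm
  -- The triangle is `v`, `x`, `y`: `z` misses `x`, and `t` is a non-neighbour of `y`, which exists
  -- because `y` is not universal.
  refine triangle_of_card_le hlow (hv x hx) (hv y hy) hxy (u := z) (v := t) (w := z)
    ⟨hz, hxz.symm, fun h => hnxz (h.1 (hv z hz).symm).symm⟩
    ⟨htv, hty, fun h => hnt (h.1 (hv t htv).symm).symm⟩
    ⟨hxz.symm, hyz.ne.symm, fun h => hnxz (h.2 hyz.symm).symm⟩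

theorem isCompleteMinus_of_two_universal [Fintype V]
    (hlow : Fintype.card V ≤ strongPartitionDim G + 1) {c d x z : V} (hcd : c ≠ d)
    (hc : ∀ x, x ≠ c → G.Adj c x) (hd : ∀ x, x ≠ d → G.Adj d x)
    (hxz : x ≠ z) (hn : ¬ G.Adj x z) : IsCompleteMinus G x z := by
  have sy := fun x y => G.adj_comm x y
  have ir := fun x => G.irrefl (v := x)
  have hT := fun {a b e u v w : V} => triangle_of_card_le (a := a) (b := b) (c := e) (u := u)
    (v := v) (w := w) hlow
  have hM := fun {a b e f w : V} => pairs_of_card_le (a := a) (b := b) (c := e) (d := f)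
    (w := w) hlow
  have key : ∀ w t, w ≠ x → w ≠ z → t ≠ w → G.Adj w t := by
    intro w t hwx hwz htw
    by_contra hnt
    have hxc : x ≠ c := by grind
    have hxd : x ≠ d := by grind
    have hzc : z ≠ c := by grind
    have hzd : z ≠ d := by grind
    have hwc : w ≠ c := by grind
    have hwd : w ≠ d := by grind
    by_cases h1 : G.Adj w x
    · by_cases h2 : G.Adj w z
      · refine hT (hc x hxc) (hc w hwc) h1.symm (u := z) (v := t) (w := z) ?_ ?_ ?_ <;>
          unfold Separates <;> grind
      · refine hM (hc x hxc) (hd w hwd) (w := z) ?_ ?_ ?_ ?_ ?_ ?_ <;>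
          first | (unfold Separates; grind) | grind
    · refine hM (hc z hzc) (hd w hwd) (w := x) ?_ ?_ ?_ ?_ ?_ ?_ <;>
        first | (unfold Separates; grind) | grind
  refine ⟨hxz, fun p q => ?_⟩
  have := key p q
  have := key q p
  grind

theorem exists_isFourCycle [Fintype V] (hG : G.Connected)
    (hlow : Fintype.card V ≤ strongPartitionDim G + 1)
    (hN : ∀ x, ∃ y, y ≠ x ∧ ¬ G.Adj x y) : ∃ a b c d, IsFourCycle G a b c d := by
  have sy := fun x y => G.adj_comm x y
  have ir := fun x => G.irrefl (v := x)
  have hT := fun {a b e u v w : V} => triangle_of_card_le (a := a) (b := b) (c := e) (u := u)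
    (v := v) (w := w) hlow
  have hM := fun {a b e f w : V} => pairs_of_card_le (a := a) (b := b) (c := e) (d := f)
    (w := w) hlow
  have hC := fun {x y : V} => exists_common_neighbor (x := x) (y := y) hG hlow
  -- No induced path `e a b c`: a common neighbour `f` of its ends gives a separated triangle, or
  -- else closes an induced five-cycle, where `f` separates two disjoint edges.
  have hP4 : ∀ a b c e, e ≠ b → e ≠ c → a ≠ c → G.Adj e a → G.Adj a b → G.Adj b c →
      ¬ G.Adj a c → ¬ G.Adj e b → ¬ G.Adj e c → False := by
    intro a b c e heb hec hac hea hab hbc nac neb nec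
    obtain ⟨f, hef, hfc⟩ := hC hec nec
    have hfa : ¬ G.Adj f a := fun hfa => by
      refine hT hef hea hfa (u := c) (v := b) (w := c) ?_ ?_ ?_ <;>
        unfold Separates <;> grind
    have hfb : ¬ G.Adj f b := fun hfb => by
      refine hT hfb hfc hbc (u := e) (v := e) (w := a) ?_ ?_ ?_ <;>
        unfold Separates <;> grind
    refine hM hea hbc (w := f) ?_ ?_ ?_ ?_ ?_ ?_ <;>
      first | (unfold Separates; grind) | grind
  -- No vertex outside an induced four-cycle is adjacent to two consecutive vertices of it; `hQ`
  -- extends this to a single vertex of the cycle.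
  have hQ2 : ∀ a b c e g, a ≠ c → b ≠ e → G.Adj a b → G.Adj b c → G.Adj c e → G.Adj e a →
      ¬ G.Adj a c → ¬ G.Adj b e → g ≠ a → g ≠ b → g ≠ c → g ≠ e → G.Adj g a → G.Adj g b →
      False := by
    intro a b c e g hac hbe hab hbc hce hea nac nbe hga hgb hgc hge aga agb
    by_cases agc : G.Adj g c
    · by_cases age : G.Adj g e
      · refine hT aga agb hab (u := c) (v := e) (w := c) ?_ ?_ ?_ <;>
          unfold Separates <;> grind
      · refine hM hbc.symm aga.symm (w := e) ?_ ?_ ?_ ?_ ?_ ?_ <;>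
          first | (unfold Separates; grind) | grind
    · by_cases age : G.Adj g e
      · refine hM hab age (w := c) ?_ ?_ ?_ ?_ ?_ ?_ <;>
          first | (unfold Separates; grind) | grind
      · refine hT aga agb hab (u := e) (v := c) (w := c) ?_ ?_ ?_ <;>
          unfold Separates <;> grind
  have hQ : ∀ a b c e g, a ≠ c → b ≠ e → G.Adj a b → G.Adj b c → G.Adj c e → G.Adj e a →
      ¬ G.Adj a c → ¬ G.Adj b e → g ≠ a → g ≠ b → g ≠ c → g ≠ e → ¬ G.Adj g a := by
    intro a b c e g hac hbe hab hbc hce hea nac nbe hga hgb hgc hge aga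
    by_cases agb : G.Adj g b
    · exact hQ2 a b c e g hac hbe hab hbc hce hea nac nbe hga hgb hgc hge aga agb
    by_cases age : G.Adj g e
    · exact hQ2 a e c b g hac hbe.symm hea.symm hce.symm hbc.symm hab.symm nac
        (fun h => nbe h.symm) hga hge hgc hgb aga age
    refine hM aga hbc (w := e) ?_ ?_ ?_ ?_ ?_ ?_ <;>
      first | (unfold Separates; grind) | grind
  obtain ⟨a⟩ := hG.nonempty
  obtain ⟨c, hca, nac⟩ := hN a
  obtain ⟨b, hab, hbc⟩ := hC hca.symm nac
  obtain ⟨e, heb, nbe⟩ := hN b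
  by_cases hea : G.Adj e a
  swap
  · exfalso
    by_cases hec : G.Adj e c
    · exact hP4 c b a e heb (by grind) hca hec hbc.symm hab.symm (by grind) (by grind) hea
    · obtain ⟨f, hef, hfa⟩ := hC (show e ≠ a by grind) hea
      refine hM hbc hef.symm (w := a) ?_ ?_ ?_ ?_ ?_ ?_ <;>
        first | (unfold Separates; grind) | grind
  by_cases hec : G.Adj e c
  swap
  · exact (hP4 a b c e heb (by grind) hca.symm hea hab hbc nac (by grind) hec).elim
  have hout : ∀ g, g ≠ a → g ≠ b → g ≠ c → g ≠ e →
      ¬ G.Adj g a ∧ ¬ G.Adj g b ∧ ¬ G.Adj g c ∧ ¬ G.Adj g e := fun g h1 h2 h3 h4 =>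
    ⟨hQ a b c e g hca.symm heb.symm hab hbc hec.symm hea nac nbe h1 h2 h3 h4,
      hQ b c e a g heb.symm hca hbc hec.symm hea hab nbe (by grind) h2 h3 h4 h1,
      hQ c e a b g hca heb hec.symm hea hab hbc (by grind) (by grind) h3 h4 h1 h2,
      hQ e a b c g heb hca.symm hea hab hbc hec.symm (by grind) nac h4 h1 h2 h3⟩
  refine ⟨a, b, c, e, fun g => ?_, hca.symm, heb.symm, hab, hbc, hec.symm, hea, nac, nbe⟩
  -- A common neighbour of `g` and `a` would itself lie outside the cycle, yet be adjacent to `a`.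
  by_contra! hg
  obtain ⟨h1, h2, h3, h4⟩ := hg
  have hg := hout g h1 h2 h3 h4
  obtain ⟨f, hgf, hfa⟩ := hC h1 hg.1
  exact (hout f hfa.ne (by grind) (by grind) (by grind)).1 hfa

/-- A connected graph of order `n` has strong partition dimension `n - 1` if and only if it has
one of three shapes. -/
theorem strongPartitionDim_eq_card_sub_one_iff [Fintype V] (hG : G.Connected) :
    strongPartitionDim G = Fintype.card V - 1 ↔
      (∃ a b c d, IsFourCycle G a b c d) ∨ (∃ u v, IsCompleteMinus G u v) ∨
        ∃ v, IsCliqueStar G v := by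
  constructor
  · intro h
    have hn := exists_nonadj_of_strongPartitionDim_eq hG h
    have hlow : Fintype.card V ≤ strongPartitionDim G + 1 := by omega
    by_cases hN : ∀ x, ∃ y, y ≠ x ∧ ¬ G.Adj x y
    · exact Or.inl (exists_isFourCycle hG hlow hN)
    push Not at hN
    obtain ⟨c, hc⟩ := hN
    by_cases hd : ∀ y, y ≠ c → ∃ z, z ≠ y ∧ ¬ G.Adj y z
    · exact Or.inr (Or.inr ⟨c, isCliqueStar_of_unique_universal hlow hc hd hn⟩)
    push Not at hd
    obtain ⟨d, hdc, hd⟩ := hd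
    obtain ⟨x, z, hxz, hn⟩ := hn
    exact Or.inr (Or.inl ⟨x, z, isCompleteMinus_of_two_universal hlow hdc.symm hc hd hxz hn⟩)
  · rintro (⟨a, b, c, d, h⟩ | ⟨u, v, h⟩ | ⟨v, h⟩)
    exacts [h.strongPartitionDim_eq hG, h.strongPartitionDim_eq hG, h.strongPartitionDim_eq hG]

/-! ### Translation into isomorphisms -/

theorem exists_isFourCycle_iff :
    (∃ a b c d, IsFourCycle G a b c d) ↔ Nonempty (G ≃g SimpleGraph.cycleGraph 4) := by
  constructor
  · rintro ⟨a, b, c, d, hall, hac, hbd, hab, hbc, hcd, hda, nac, nbd⟩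
    have sy := fun x y => G.adj_comm x y
    have ir := fun x => G.irrefl (v := x)
    have hinj : Function.Injective ![a, b, c, d] := by
      have := hab.ne; have := hbc.ne; have := hcd.ne; have := hda.ne
      intro i j h
      fin_cases i <;> fin_cases j <;> simp at h ⊢ <;> grind
    have hsurj : Function.Surjective ![a, b, c, d] := by
      intro x
      rcases hall x with rfl | rfl | rfl | rfl
      exacts [⟨0, rfl⟩, ⟨1, rfl⟩, ⟨2, rfl⟩, ⟨3, rfl⟩]
    have hbij : Function.Bijective ![a, b, c, d] := ⟨hinj, hsurj⟩
    -- In `C_4` the only non-neighbour of a vertex is the opposite one, two steps away modulo 4.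
    have hadj : ∀ i j : Fin 4, (SimpleGraph.cycleGraph 4).Adj i j ↔ i ≠ j ∧ i ≠ j + 2 := by
      decide
    refine ⟨RelIso.symm ⟨Equiv.ofBijective _ hbij, ?_⟩⟩
    intro i j
    rw [hadj, Equiv.ofBijective_apply, Equiv.ofBijective_apply]
    fin_cases i <;> fin_cases j <;> simp <;> grind
  · rintro ⟨f⟩
    have hf : ∀ i j, G.Adj (f.symm i) (f.symm j) ↔ (SimpleGraph.cycleGraph 4).Adj i j :=
      fun i j => f.symm.map_adj_iff
    refine ⟨f.symm 0, f.symm 1, f.symm 2, f.symm 3, ?_⟩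
    refine ⟨fun x => ?_, f.symm.injective.ne (by decide), f.symm.injective.ne (by decide), ?_⟩
    · obtain ⟨i, rfl⟩ := f.symm.surjective x
      fin_cases i <;> simp
    · simp only [hf]
      decide

theorem exists_isCompleteMinus_iff [Fintype V] :
    (∃ u v, IsCompleteMinus G u v) ↔ ∃ u v : Fin (Fintype.card V), u ≠ v ∧ Nonempty
      (G ≃g (SimpleGraph.completeGraph (Fin (Fintype.card V))).deleteEdges {s(u, v)}) := by
  constructor
  · rintro ⟨u, v, huv, h⟩
    let e := Fintype.equivFin V
    refine ⟨e u, e v, e.injective.ne huv, ⟨e, ?_⟩⟩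
    intro x y
    simp [SimpleGraph.deleteEdges_adj, h]
  · rintro ⟨u, v, huv, ⟨f⟩⟩
    refine ⟨f.symm u, f.symm v, f.symm.injective.ne huv, fun x y => ?_⟩
    rw [← f.map_adj_iff]
    simp [SimpleGraph.deleteEdges_adj, RelIso.eq_symm_apply]

theorem exists_isCompleteMinus_of_pathGraph (f : G ≃g SimpleGraph.pathGraph 3) :
    ∃ u v, IsCompleteMinus G u v := by
  have hadj : ∀ i j : Fin 3, (SimpleGraph.pathGraph 3).Adj i j ↔
      i ≠ j ∧ ¬ (i = 0 ∧ j = 2) ∧ ¬ (i = 2 ∧ j = 0) := by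
    simp only [SimpleGraph.pathGraph_adj]
    decide
  refine ⟨f.symm 0, f.symm 2, f.symm.injective.ne (by decide), fun x y => ?_⟩
  rw [← f.map_adj_iff, hadj]
  simp [RelIso.eq_symm_apply]

theorem disjointUnion_completeGraph_adj {ι : Type*} {W : ι → Type*} {x y : Σ i, W i} :
    (disjointUnion fun i => SimpleGraph.completeGraph (W i)).Adj x y ↔ x.1 = y.1 ∧ x ≠ y := by
  constructor
  · rintro ⟨i, a, b, h, rfl, rfl⟩
    exact ⟨rfl, fun e => h (by simpa using e)⟩
  · obtain ⟨i, a⟩ := x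
    obtain ⟨j, b⟩ := y
    rintro ⟨h, hne⟩
    obtain rfl : i = j := h
    exact ⟨i, a, b, fun e : a = b => hne (by rw [e]), rfl, rfl⟩

theorem isCliqueStar_of_iso {k : ℕ} {m : Fin k → ℕ} (hk : 1 < k) (hm : ∀ i, 1 ≤ m i)
    (f : G ≃g join (SimpleGraph.completeGraph (Fin 1))
      (disjointUnion fun i => SimpleGraph.completeGraph (Fin (m i)))) :
    IsCliqueStar G (f.symm (Sum.inl 0)) := by
  have hf : ∀ s t, G.Adj (f.symm s) (f.symm t) ↔ _ := fun s t => f.symm.map_adj_iff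
  have hne : ∀ s, f.symm s ≠ f.symm (Sum.inl 0) → ∃ t, s = Sum.inr t := by
    rintro (i | t) h
    · exact absurd (by rw [Subsingleton.elim i 0]) h
    · exact ⟨t, rfl⟩
  refine ⟨fun x => ?_, fun x y z => ?_, ?_⟩
  · obtain ⟨s, rfl⟩ := f.symm.surjective x
    intro h
    obtain ⟨t, rfl⟩ := hne s h
    exact (hf _ _).2 trivial
  · obtain ⟨s, rfl⟩ := f.symm.surjective x
    obtain ⟨t, rfl⟩ := f.symm.surjective y
    obtain ⟨u, rfl⟩ := f.symm.surjective z
    intro h1 h2 h3 hsu h4 h5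
    obtain ⟨s, rfl⟩ := hne s h1
    obtain ⟨t, rfl⟩ := hne t h2
    obtain ⟨u, rfl⟩ := hne u h3
    have h4 := disjointUnion_completeGraph_adj.1 ((hf _ _).1 h4)
    have h5 := disjointUnion_completeGraph_adj.1 ((hf _ _).1 h5)
    exact (hf _ _).2 (disjointUnion_completeGraph_adj.2
      ⟨h4.1.trans h5.1, by rintro rfl; exact hsu rfl⟩)
  · let i : Fin k := ⟨0, by omega⟩
    let j : Fin k := ⟨1, hk⟩
    have hij : i ≠ j := by simp [i, j]
    refine ⟨f.symm (Sum.inr ⟨i, ⟨0, hm i⟩⟩), f.symm (Sum.inr ⟨j, ⟨0, hm j⟩⟩),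
      f.symm.injective.ne ?_, fun h => ?_⟩
    · intro h
      exact hij (congrArg Sigma.fst (Sum.inr_injective h))
    · exact hij (disjointUnion_completeGraph_adj.1 ((hf _ _).1 h)).1

theorem IsCliqueStar.exists_iso [Fintype V] {v : V} (h : IsCliqueStar G v) :
    ∃ (k : ℕ) (m : Fin k → ℕ), 1 < k ∧ (∀ i, 1 ≤ m i) ∧ ∑ i, m i = Fintype.card V - 1 ∧
      Nonempty (G ≃g join (SimpleGraph.completeGraph (Fin 1))
        (disjointUnion fun i => SimpleGraph.completeGraph (Fin (m i)))) := by
  classical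
  obtain ⟨hv, ht, p, q, hpq, hn⟩ := h
  -- The classes of this relation are the cliques of `G - v`; their sizes become the `m i`.
  let S : Setoid {x // x ≠ v} :=
    { r := fun x y => x = y ∨ G.Adj x y
      iseqv :=
        { refl := fun x => Or.inl rfl
          symm := fun h => h.imp Eq.symm fun h => h.symm
          trans := by
            rintro x y z (rfl | h) (rfl | h')
            · exact Or.inl rfl
            · exact Or.inr h'
            · exact Or.inr h
            · by_cases hxz : x = z
              · exact Or.inl hxz
              · exact Or.inr (ht x y z x.2 y.2 z.2 (fun e => hxz (Subtype.ext e)) h h') } }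
  let e : Quotient S ≃ Fin (Fintype.card (Quotient S)) := Fintype.equivFin _
  let c : {x // x ≠ v} → Fin (Fintype.card (Quotient S)) := fun x => e ⟦x⟧
  have hc : ∀ x y, c x = c y ↔ x = y ∨ G.Adj x y := fun x y =>
    e.injective.eq_iff.trans Quotient.eq
  have hcs : Function.Surjective c := e.surjective.comp Quotient.mk_surjective
  let m : Fin (Fintype.card (Quotient S)) → ℕ := fun i => Fintype.card {x // c x = i}
  let g : (Σ i, Fin (m i)) ≃ {x // x ≠ v} :=
    (Equiv.sigmaCongrRight fun i => (Fintype.equivFin {x // c x = i}).symm).trans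
      (Equiv.sigmaFiberEquiv c)
  have hg : ∀ s, c (g s) = s.1 := fun s => ((Fintype.equivFin {x // c x = s.1}).symm s.2).2
  have hpv : p ≠ v := by rintro rfl; exact hn (hv q hpq.symm)
  have hqv : q ≠ v := by rintro rfl; exact hn (hv p hpq).symm
  refine ⟨_, m, ?_, fun i => ?_, ?_, ⟨RelIso.symm ⟨(Equiv.sumCongr
    (Equiv.ofUnique (Fin 1) {x // x = v}) g).trans (Equiv.sumCompl fun x => x = v), ?_⟩⟩⟩
  · rw [← Fintype.card_fin (Fintype.card (Quotient S)), Fintype.one_lt_card_iff]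
    refine ⟨c ⟨p, hpv⟩, c ⟨q, hqv⟩, fun h => ?_⟩
    rcases (hc _ _).1 h with h | h
    · exact hpq (congrArg Subtype.val h)
    · exact hn h
  · obtain ⟨x, hx⟩ := hcs i
    exact Fintype.card_pos_iff.2 ⟨⟨x, hx⟩⟩
  · have := Fintype.card_congr g
    simpa [Fintype.card_subtype_compl] using this
  · rintro (s | s) (t | t)
    · exact ⟨fun h => (G.irrefl h).elim, fun h => absurd (Subsingleton.elim s t) h⟩
    · exact ⟨fun _ => trivial, fun _ => hv _ (g t).2⟩
    · exact ⟨fun _ => trivial, fun _ => (hv _ (g s).2).symm⟩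
    · refine Iff.trans ?_ disjointUnion_completeGraph_adj.symm
      change G.Adj (g s) (g t) ↔ _
      rw [← hg s, ← hg t, hc, ← g.injective.ne_iff]
      constructor
      · exact fun h => ⟨Or.inr h, fun e => G.irrefl (e ▸ h)⟩
      · exact fun h => h.1.resolve_left h.2

end StrongPartition

theorem mainTheorem1 {V : Type*} [Fintype V] (G : SimpleGraph V) (hG : G.Connected) :
    StrongPartition.strongPartitionDim G = Fintype.card V - 1 ↔
      (Nonempty (G ≃g SimpleGraph.pathGraph 3) ∨
        Nonempty (G ≃g SimpleGraph.cycleGraph 4) ∨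
        (∃ u v : Fin (Fintype.card V), u ≠ v ∧
          Nonempty (G ≃g (SimpleGraph.completeGraph (Fin (Fintype.card V))).deleteEdges {s(u, v)})) ∨
        (∃ (k : ℕ) (m : Fin k → ℕ), 1 < k ∧ (∀ i, 1 ≤ m i) ∧
          ∑ i, m i = Fintype.card V - 1 ∧
          Nonempty (G ≃g StrongPartition.join (SimpleGraph.completeGraph (Fin 1))
            (StrongPartition.disjointUnion
              fun i => SimpleGraph.completeGraph (Fin (m i)))))) := by
  rw [StrongPartition.strongPartitionDim_eq_card_sub_one_iff hG,
    StrongPartition.exists_isFourCycle_iff, ← StrongPartition.exists_isCompleteMinus_iff]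
  constructor
  · rintro (h | h | ⟨v, h⟩)
    exacts [Or.inr (Or.inl h), Or.inr (Or.inr (Or.inl h)), Or.inr (Or.inr (Or.inr h.exists_iso))]
  · rintro (⟨⟨f⟩⟩ | h | h | ⟨k, m, hk, hm, -, ⟨f⟩⟩)
    exacts [Or.inr (Or.inl (StrongPartition.exists_isCompleteMinus_of_pathGraph f)), Or.inl h,
      Or.inr (Or.inl h), Or.inr (Or.inr ⟨_, StrongPartition.isCliqueStar_of_iso hk hm f⟩)]
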